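/- Let $\Omega\subset\mathbb R^d$ be an open set (in particular, $\Omega$ may be a bounded Lipschitz domain) and let $\gamma$ be a finite positive Borel measure on $\Omega$. Let $\mathfrak M(\Omega;\mathbb R^d)$ be the space of finite $\mathbb R^d$-valued Radon measures on $\Omega$; for $g\in\mathfrak M(\Omega;\mathbb R^d)$ let $|g|$ be its variation measure (with respect to the Euclidean norm of $\mathbb R^d$) and $\|g\|_{\mathfrak M}=|g|(\Omega)$. Let $BV(\Omega)$ be the space of all $u\in L^1(\Omega)$ whose weak gradient $Du$ belongs to $\mathfrak M(\Omega;\mathbb R^d)$, with the norm $\|u\|_{L^1}+\|Du\|_{\mathfrak M}$. Let $Z$ be the predual of $BV(\Omega)$, realised as the norm closure in $BV(\Omega)^*$ of the functionals $u\mapsto\int_\Omega u\,\psi\,dx$, $\psi\in C_c^\infty(\Omega)$; each $u\in BV(\Omega)$ is regarded as the element $p\mapsto\langle p,u\rangle$ of $Z^*$. For $\phi\in C_c^\infty(\Omega;\mathbb R^d)$ let $D^*\phi=-\operatorname{div}\phi\in Z$, that is, $\langle D^*\phi,u\rangle=\int_\Omega\phi\cdot dDu=-\int_\Omega u\operatorname{div}\phi\,dx$.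 Define $F\colon Z\to[0,+\infty]$ by $$F(p)=\inf\Big\{\int_\Omega|\phi|\,d\gamma\;:\;\phi\in C_c^\infty(\Omega;\mathbb R^d),\ |\phi|\le 1\text{ on }\Omega,\ D^*\phi=p\Big\},\qquad \inf\emptyset=+\infty,$$ where $|\phi|$ is the pointwise Euclidean norm. Then the convex conjugate of $F$ is $\mathrm{TV}^{\gamma}_{\mathrm{pwL}}$: for every $u\in BV(\Omega)$, $$F^*(u)=\sup_{p\in Z}\big(\langle p,u\rangle-F(p)\big)=\mathrm{TV}^{\gamma}_{\mathrm{pwL}}(u):=\min\big\{\|Du-g\|_{\mathfrak M}\;:\;g\in\mathfrak M(\Omega;\mathbb R^d),\ |g|\le\gamma\big\},$$ and the minimum on the right is attained. -/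

import Mathlib

open MeasureTheory TopologicalSpace
open scoped Distributions ENNReal

noncomputable section

namespace TVpwL

/-- Euclidean space `ℝ^d`, with the `2`-norm. -/
abbrev Euc (d : ℕ) : Type := EuclideanSpace ℝ (Fin d)

variable {d : ℕ} {Ω : Opens (Euc d)}

/-! ### Test functions and the divergence -/

/-- The divergence `∑ i, ∂ᵢ φᵢ` of a smooth compactly supported vector field on `Ω`,
again a smooth compactly supported function on `Ω`. -/
def divergence (φ : 𝓓(Ω, Euc d)) : 𝓓(Ω, ℝ) where
  toFun x := ∑ i, (fderiv ℝ φ x (EuclideanSpace.single i 1)) i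
  contDiff' := by
    have h : ContDiff ℝ (((⊤ : ℕ∞) : WithTop ℕ∞)) (fderiv ℝ φ) :=
      φ.contDiff.fderiv_right (by simp)
    refine ContDiff.sum fun i _ => ?_
    exact (EuclideanSpace.proj (𝕜 := ℝ) i).contDiff.comp (h.clm_apply contDiff_const)
  hasCompactSupport' := by
    refine φ.hasCompactSupport.mono' ?_
    refine Set.Subset.trans ?_ (support_fderiv_subset ℝ)
    intro x hx h0
    exact hx (by simp [h0])
  tsupport_subset' := by
    refine Set.Subset.trans (closure_minimal ?_ (isClosed_tsupport _)) φ.tsupport_subset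
    refine Set.Subset.trans ?_ (support_fderiv_subset ℝ)
    intro x hx h0
    exact hx (by simp [h0])

variable (Ω) in
/-- Lebesgue measure on `Ω`. -/
def lebesgue : Measure Ω := Measure.comap Subtype.val (volume : Measure (Euc d))

theorem integrable_mul_test (u : Lp ℝ 1 (lebesgue Ω)) (ψ : 𝓓(Ω, ℝ)) :
    Integrable (fun x : Ω => u x * ψ x) (lebesgue Ω) := by
  obtain ⟨C, hC⟩ := ψ.continuous.bounded_above_of_compact_support ψ.hasCompactSupport
  refine (L1.integrable_coeFn u).mul_bdd (c := C) ?_ (.of_forall fun x => hC x)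
  exact (ψ.continuous.comp continuous_subtype_val).aestronglyMeasurable

theorem integrable_test (μ : VectorMeasure Ω (Euc d)) [IsFiniteMeasure μ.variation]
    (φ : 𝓓(Ω, Euc d)) : μ.Integrable (fun x : Ω => φ x) := by
  obtain ⟨C, hC⟩ := φ.continuous.bounded_above_of_compact_support φ.hasCompactSupport
  refine Integrable.of_bound ?_ C (.of_forall fun x => hC x)
  exact (φ.continuous.comp continuous_subtype_val).aestronglyMeasurable

/-! ### Vector-valued Radon measures -/

variable (Ω) in
/-- The space `𝔐(Ω; ℝ^d)` of finite `ℝ^d`-valued Radon measures on `Ω`: the countably additive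
Borel vector measures whose variation measure is finite. -/
def RadonMeasure : Submodule ℝ (VectorMeasure Ω (Euc d)) where
  carrier := {μ | IsFiniteMeasure μ.variation}
  zero_mem' := by
    change IsFiniteMeasure (0 : VectorMeasure Ω (Euc d)).variation
    rw [VectorMeasure.variation_zero]
    infer_instance
  add_mem' {μ ν} hμ hν := by
    have := hμ.out
    have := hν.out
    exact isFiniteMeasure_of_le _ VectorMeasure.variation_add_le
  smul_mem' c μ hμ := by
    have : IsFiniteMeasure μ.variation := hμ
    exact (inferInstance : IsFiniteMeasure (c • μ).variation)

instance (μ : RadonMeasure Ω) : IsFiniteMeasure (μ : VectorMeasure Ω (Euc d)).variation := μ.2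

/-- The Radon norm `‖μ‖ = |μ|(Ω)`. -/
instance : Norm (RadonMeasure Ω) where
  norm μ := (μ : VectorMeasure Ω (Euc d)).variation.real Set.univ

theorem RadonMeasure.norm_def (μ : RadonMeasure Ω) :
    ‖μ‖ = (μ : VectorMeasure Ω (Euc d)).variation.real Set.univ := rfl

theorem RadonMeasure.normedSpaceCore : NormedSpace.Core ℝ (RadonMeasure Ω) where
  norm_nonneg _ := measureReal_nonneg
  norm_smul c μ := by
    simp [RadonMeasure.norm_def, VectorMeasure.variation_smul, Measure.real]
  norm_triangle μ ν := by
    have h := VectorMeasure.variation_add_le (μ := (μ : VectorMeasure Ω (Euc d)))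
      (ν := (ν : VectorMeasure Ω (Euc d))) Set.univ
    simp only [RadonMeasure.norm_def, Measure.real]
    rw [← ENNReal.toReal_add (by finiteness) (by finiteness)]
    exact ENNReal.toReal_mono (by finiteness) h
  norm_eq_zero_iff μ := by
    simp [RadonMeasure.norm_def, measureReal_eq_zero_iff]

instance : NormedAddCommGroup (RadonMeasure Ω) :=
  NormedAddCommGroup.ofCore RadonMeasure.normedSpaceCore

instance : NormedSpace ℝ (RadonMeasure Ω) :=
  NormedSpace.ofCore RadonMeasure.normedSpaceCore

/-- The duality pairing `∫ φ · dμ` of a test vector field with a vector measure. -/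
def pairing (φ : 𝓓(Ω, Euc d)) (μ : RadonMeasure Ω) : ℝ :=
  ∫ᵛ x, φ x ∂[innerSL ℝ; (μ : VectorMeasure Ω (Euc d))]

theorem pairing_add (φ : 𝓓(Ω, Euc d)) (μ ν : RadonMeasure Ω) :
    pairing φ (μ + ν) = pairing φ μ + pairing φ ν :=
  VectorMeasure.integral_add_vectorMeasure (integrable_test _ φ) (integrable_test _ φ)

theorem pairing_smul (φ : 𝓓(Ω, Euc d)) (c : ℝ) (μ : RadonMeasure Ω) :
    pairing φ (c • μ) = c * pairing φ μ :=
  VectorMeasure.integral_smul_vectorMeasure _ c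

theorem abs_pairing_le (φ : 𝓓(Ω, Euc d)) :
    ∃ C : ℝ, ∀ μ : RadonMeasure Ω, |pairing φ μ| ≤ C * ‖μ‖ := by
  obtain ⟨C, hC⟩ := φ.continuous.bounded_above_of_compact_support φ.hasCompactSupport
  refine ⟨C * ‖innerSL ℝ (E := Euc d)‖, fun μ => ?_⟩
  exact VectorMeasure.norm_integral_le_of_norm_le_const
    (μ := (μ : VectorMeasure Ω (Euc d))) (f := fun x : Ω => φ x) (B := innerSL ℝ)
    (.of_forall fun x => hC x)

/-- Smooth cutoff functions in `Ω` decreasing to the indicator of a compact set `K ⊆ Ω`. -/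
theorem exists_cutoff {K : Set (Euc d)} (hK : IsCompact K) (hKΩ : K ⊆ Ω) :
    ∃ g : ℕ → 𝓓(Ω, ℝ), (∀ n x, ‖g n x‖ ≤ 1) ∧ (∀ n, ∀ x ∈ K, g n x = 1) ∧
      ∀ x ∉ K, ∀ᶠ n in Filter.atTop, g n x = 0 := by
  obtain ⟨δ, hδ, hδΩ⟩ := hK.exists_cthickening_subset_open Ω.isOpen hKΩ
  obtain ⟨δ', hδ', hδc⟩ := hK.exists_isCompact_cthickening
  obtain ⟨w, -, hw, hw0⟩ : ∃ w : ℕ → ℝ, StrictAnti w ∧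
      (∀ n, w n ∈ Set.Ioo 0 (min δ δ')) ∧ Filter.Tendsto w Filter.atTop (nhds 0) :=
    exists_seq_strictAnti_tendsto' (lt_min hδ hδ')
  have hex : ∀ n, ∃ g : Euc d → ℝ, ContDiff ℝ ((⊤ : ℕ∞) : WithTop ℕ∞) g ∧
      Set.range g ⊆ Set.Icc 0 1 ∧ Function.support g = Metric.thickening (w n) K ∧
      ∀ x ∈ K, g x = 1 := by
    intro n
    obtain ⟨g, hg, hr, hs, h1⟩ := exists_contMDiff_support_eq_eq_one_iff
      (modelWithCornersSelf ℝ (Euc d)) (n := ⊤) (Metric.isOpen_thickening (δ := w n)) hK.isClosed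
      (Metric.self_subset_thickening (hw n).1 K)
    exact ⟨g, hg.contDiff, hr, hs, fun x hx => (h1 x).1 hx⟩
  choose g hg hr hs h1 using hex
  have hts : ∀ n, tsupport (g n) ⊆ Metric.cthickening (w n) K := by
    intro n
    rw [tsupport, hs]
    exact Metric.closure_thickening_subset_cthickening _ _
  refine ⟨fun n =>
    { toFun := g n
      contDiff' := hg n
      hasCompactSupport' := hδc.of_isClosed_subset (isClosed_tsupport _) ((hts n).trans
        (Metric.cthickening_mono ((hw n).2.le.trans (min_le_right _ _)) _))
      tsupport_subset' := ((hts n).trans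
        (Metric.cthickening_mono ((hw n).2.le.trans (min_le_left _ _)) _)).trans hδΩ },
    fun n x => ?_, h1, fun x hx => ?_⟩
  · have hx := hr n (Set.mem_range_self x)
    exact (Real.norm_of_nonneg hx.1).trans_le hx.2
  · obtain ⟨ε, hε, hxε⟩ : ∃ ε, 0 < ε ∧ x ∉ Metric.thickening ε K := by
      rw [← hK.isClosed.closure_eq, Metric.closure_eq_iInter_thickening] at hx
      simpa using hx
    filter_upwards [(tendsto_order.1 hw0).2 _ hε] with n hn
    change g n x = 0
    rw [← Function.notMem_support, hs]
    exact fun hmem => hxε (Metric.thickening_mono hn.le _ hmem)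

/-- The test vector field `g e`, for a scalar test function `g` and a vector `e`. -/
def smulVec (g : 𝓓(Ω, ℝ)) (e : Euc d) : 𝓓(Ω, Euc d) where
  toFun x := g x • e
  contDiff' := g.contDiff.smul contDiff_const
  hasCompactSupport' := g.hasCompactSupport.smul_right
  tsupport_subset' := (tsupport_smul_subset_left _ _).trans g.tsupport_subset

/-- A vector measure is determined by its integrals against test vector fields. -/
theorem eq_zero_of_pairing_eq_zero (μ : RadonMeasure Ω)
    (h : ∀ φ : 𝓓(Ω, Euc d), pairing φ μ = 0) : μ = 0 := by
  have hK : ∀ K : Set Ω, IsCompact K → (μ : VectorMeasure Ω (Euc d)) K = 0 := by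
    intro K hK
    obtain ⟨g, hg, hg1, hg0⟩ := exists_cutoff (Ω := Ω) (K := Subtype.val '' K)
      (hK.image continuous_subtype_val) (by rintro _ ⟨x, -, rfl⟩; exact x.2)
    refine ext_inner_left ℝ fun e => ?_
    have hlim : Filter.Tendsto (fun n => pairing (smulVec (g n) e) μ) Filter.atTop
        (nhds (∫ᵛ x, K.indicator (fun _ => e) x
          ∂[innerSL ℝ; (μ : VectorMeasure Ω (Euc d))])) := by
      refine VectorMeasure.tendsto_integral_of_dominated_convergence (fun _ => ‖e‖) ?_
        (integrable_const _) ?_ ?_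
      · exact fun n =>
          ((smulVec (g n) e).continuous.comp continuous_subtype_val).aestronglyMeasurable
      · refine fun n => .of_forall fun x => ?_
        change ‖g n x • e‖ ≤ ‖e‖
        rw [norm_smul]
        exact mul_le_of_le_one_left (norm_nonneg _) (hg n x)
      · refine .of_forall fun x => ?_
        change Filter.Tendsto (fun n => g n x • e) _ _
        by_cases hx : x ∈ K
        · simp [hg1 _ _ (Set.mem_image_of_mem Subtype.val hx), hx]
        · rw [Set.indicator_of_notMem hx]
          refine tendsto_const_nhds.congr' ?_
          filter_upwards [hg0 x (by simpa using hx)] with n hn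
          rw [hn, zero_smul]
    rw [VectorMeasure.integral_indicator_const _ hK.measurableSet] at hlim
    have h0 : (0 : ℝ) = innerSL ℝ e ((μ : VectorMeasure Ω (Euc d)) K) :=
      tendsto_nhds_unique (by simp [h]) hlim
    simpa using h0.symm
  have : LocallyCompactSpace Ω := Ω.isOpen.locallyCompactSpace
  have hC : ∀ F : Set Ω, IsClosed F → (μ : VectorMeasure Ω (Euc d)) F = 0 := by
    intro F hF
    have ht := VectorMeasure.tendsto_vectorMeasure_iUnion_atTop_nat
      (v := (μ : VectorMeasure Ω (Euc d))) (s := fun n => F ∩ compactCovering Ω n)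
      (fun m n hmn => Set.inter_subset_inter_right _ (compactCovering_subset Ω hmn))
      (fun n => ((isCompact_compactCovering Ω n).inter_left hF).measurableSet)
    rw [← Set.inter_iUnion, iUnion_compactCovering, Set.inter_univ] at ht
    refine tendsto_nhds_unique ht ?_
    simp [hK _ ((isCompact_compactCovering Ω _).inter_left hF)]
  refine Subtype.ext (VectorMeasure.ext_of_generateFrom {s : Set Ω | IsClosed s} ?_ ?_ ?_ ?_)
  · intro s hs
    simpa using hC s hs
  · rw [BorelSpace.measurable_eq (α := Ω), borel_eq_generateFrom_isClosed]
  · intro s hs t ht _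
    exact IsClosed.inter hs ht
  · simpa using hC _ isClosed_univ

/-! ### Functions of bounded variation -/

/-- `μ` is the weak (distributional) gradient of `u`:
`∫ u div φ dx = - ∫ φ · dμ` for all test vector fields `φ`. -/
def IsWeakGradient (u : Lp ℝ 1 (lebesgue Ω)) (μ : RadonMeasure Ω) : Prop :=
  ∀ φ : 𝓓(Ω, Euc d), ∫ x : Ω, u x * divergence φ x ∂(lebesgue Ω) = - pairing φ μ

theorem integral_add_mul (u v : Lp ℝ 1 (lebesgue Ω)) (ψ : 𝓓(Ω, ℝ)) :
    ∫ x : Ω, (u + v : Lp ℝ 1 (lebesgue Ω)) x * ψ x ∂(lebesgue Ω) =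
      ∫ x : Ω, u x * ψ x ∂(lebesgue Ω) + ∫ x : Ω, v x * ψ x ∂(lebesgue Ω) := by
  rw [← integral_add (integrable_mul_test u ψ) (integrable_mul_test v ψ)]
  refine integral_congr_ae ?_
  filter_upwards [Lp.coeFn_add u v] with x hx
  rw [hx, Pi.add_apply, add_mul]

theorem integral_smul_mul (c : ℝ) (u : Lp ℝ 1 (lebesgue Ω)) (ψ : 𝓓(Ω, ℝ)) :
    ∫ x : Ω, (c • u : Lp ℝ 1 (lebesgue Ω)) x * ψ x ∂(lebesgue Ω) =
      c * ∫ x : Ω, u x * ψ x ∂(lebesgue Ω) := by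
  rw [← integral_const_mul]
  refine integral_congr_ae ?_
  filter_upwards [Lp.coeFn_smul c u] with x hx
  rw [hx, Pi.smul_apply, smul_eq_mul, mul_assoc]

theorem IsWeakGradient.add {u v : Lp ℝ 1 (lebesgue Ω)} {μ ν : RadonMeasure Ω}
    (hu : IsWeakGradient u μ) (hv : IsWeakGradient v ν) : IsWeakGradient (u + v) (μ + ν) := by
  intro φ
  rw [integral_add_mul, hu, hv, pairing_add]
  ring

theorem IsWeakGradient.smul (c : ℝ) {u : Lp ℝ 1 (lebesgue Ω)} {μ : RadonMeasure Ω}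
    (hu : IsWeakGradient u μ) : IsWeakGradient (c • u) (c • μ) := by
  intro φ
  rw [integral_smul_mul, hu, pairing_smul]
  ring

theorem IsWeakGradient.unique {u : Lp ℝ 1 (lebesgue Ω)} {μ ν : RadonMeasure Ω}
    (hμ : IsWeakGradient u μ) (hν : IsWeakGradient u ν) : μ = ν := by
  rw [← sub_eq_zero]
  refine eq_zero_of_pairing_eq_zero _ fun φ => ?_
  have h1 := hμ φ
  have h2 := hν φ
  have h3 := pairing_smul φ (-1) ν
  rw [neg_one_smul] at h3
  rw [sub_eq_add_neg, pairing_add, h3]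
  linarith

variable (Ω) in
/-- The functions `u ∈ L¹(Ω)` whose weak gradient is a finite Radon measure. -/
def bvSubmodule : Submodule ℝ (Lp ℝ 1 (lebesgue Ω)) where
  carrier := {u | ∃ μ : RadonMeasure Ω, IsWeakGradient u μ}
  zero_mem' := ⟨0, by
    intro φ
    have h := integral_smul_mul 0 (0 : Lp ℝ 1 (lebesgue Ω)) (divergence φ)
    have h' := pairing_smul φ 0 (0 : RadonMeasure Ω)
    rw [zero_smul, zero_mul] at h h'
    rw [h, h', neg_zero]⟩
  add_mem' := fun ⟨μ, hμ⟩ ⟨ν, hν⟩ => ⟨μ + ν, hμ.add hν⟩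
  smul_mem' := fun c _ ⟨μ, hμ⟩ => ⟨c • μ, hμ.smul c⟩

variable (Ω) in
/-- The space `BV(Ω)`; it carries the norm `‖u‖_{L¹} + ‖Du‖`, not the norm of `L¹(Ω)`. -/
def BV : Type := bvSubmodule Ω

instance : AddCommGroup (BV Ω) := inferInstanceAs (AddCommGroup (bvSubmodule Ω))

instance : Module ℝ (BV Ω) := inferInstanceAs (Module ℝ (bvSubmodule Ω))

/-- The inclusion `BV(Ω) ⊆ L¹(Ω)`. -/
def BV.toL1 : BV Ω →ₗ[ℝ] Lp ℝ 1 (lebesgue Ω) := (bvSubmodule Ω).subtype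

/-- The weak gradient `D : BV(Ω) → 𝔐(Ω; ℝ^d)`. -/
def BV.grad : BV Ω →ₗ[ℝ] RadonMeasure Ω where
  toFun u := Classical.choose (show ∃ μ, IsWeakGradient (BV.toL1 u) μ from Subtype.property u)
  map_add' u v := by
    refine IsWeakGradient.unique (Classical.choose_spec (Subtype.property (u + v))) ?_
    exact (Classical.choose_spec (Subtype.property u)).add
      (Classical.choose_spec (Subtype.property v))
  map_smul' c u := by
    refine IsWeakGradient.unique (Classical.choose_spec (Subtype.property (c • u))) ?_
    exact (Classical.choose_spec (Subtype.property u)).smul c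

theorem BV.isWeakGradient (u : BV Ω) : IsWeakGradient (BV.toL1 u) (BV.grad u) :=
  Classical.choose_spec (Subtype.property u)

instance : Norm (BV Ω) where
  norm u := ‖BV.toL1 u‖ + ‖BV.grad u‖

theorem BV.norm_def (u : BV Ω) : ‖u‖ = ‖BV.toL1 u‖ + ‖BV.grad u‖ := rfl

theorem BV.normedSpaceCore : NormedSpace.Core ℝ (BV Ω) where
  norm_nonneg u := add_nonneg (norm_nonneg _) (norm_nonneg _)
  norm_smul c u := by
    rw [BV.norm_def, BV.norm_def, map_smul, map_smul, norm_smul, norm_smul, mul_add]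
  norm_triangle u v := by
    have h1 := norm_add_le (BV.toL1 u) (BV.toL1 v)
    have h2 := norm_add_le (BV.grad u) (BV.grad v)
    rw [BV.norm_def, BV.norm_def, BV.norm_def, map_add, map_add]
    linarith
  norm_eq_zero_iff u := by
    constructor
    · intro h
      rw [BV.norm_def] at h
      have h1 : ‖BV.toL1 u‖ = 0 := by
        linarith [norm_nonneg (BV.toL1 u), norm_nonneg (BV.grad u)]
      exact Subtype.ext (norm_eq_zero.1 h1)
    · rintro rfl
      rw [BV.norm_def, map_zero, map_zero, norm_zero, norm_zero, add_zero]

instance : NormedAddCommGroup (BV Ω) := NormedAddCommGroup.ofCore BV.normedSpaceCore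

instance : NormedSpace ℝ (BV Ω) := NormedSpace.ofCore BV.normedSpaceCore

/-! ### The predual of `BV(Ω)` and the operator `D*` -/

/-- A test function `ψ`, regarded as the bounded functional `u ↦ ∫ u ψ dx` on `BV(Ω)`. -/
def testFunctional (ψ : 𝓓(Ω, ℝ)) : StrongDual ℝ (BV Ω) :=
  LinearMap.mkContinuousOfExistsBound
    { toFun := fun u => ∫ x : Ω, BV.toL1 u x * ψ x ∂(lebesgue Ω)
      map_add' := fun u v => by rw [map_add, integral_add_mul]
      map_smul' := fun c u => by rw [map_smul, integral_smul_mul]; rfl }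
    (by
      obtain ⟨C, hC⟩ := ψ.continuous.bounded_above_of_compact_support ψ.hasCompactSupport
      have hC0 : 0 ≤ C := (norm_nonneg _).trans (hC 0)
      refine ⟨C, fun u => ?_⟩
      have h : ‖∫ x : Ω, BV.toL1 u x * ψ x ∂(lebesgue Ω)‖ ≤
          ∫ x : Ω, C * ‖BV.toL1 u x‖ ∂(lebesgue Ω) := by
        refine norm_integral_le_of_norm_le ((L1.integrable_coeFn _).norm.const_mul C)
          (.of_forall fun x => ?_)
        rw [norm_mul, mul_comm]
        gcongr
        exact hC x
      rw [integral_const_mul, ← L1.norm_eq_integral_norm] at h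
      refine h.trans ?_
      gcongr
      rw [BV.norm_def]
      linarith [norm_nonneg (BV.grad u)])

variable (Ω) in
/-- The predual `Z` of `BV(Ω)`, realised in the canonical way inside the dual `BV(Ω)*`: the norm
closure of the space of functionals `u ↦ ∫ u ψ dx` with `ψ` a test function on `Ω`. -/
def Predual : Submodule ℝ (StrongDual ℝ (BV Ω)) :=
  (Submodule.span ℝ (Set.range (testFunctional (Ω := Ω)))).topologicalClosure

/-- The canonical map `BV(Ω) → Z*`, `u ↦ (p ↦ ⟨p, u⟩)`. -/
def BV.toDualPredual (u : BV Ω) : StrongDual ℝ (Predual Ω) :=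
  (NormedSpace.inclusionInDoubleDual ℝ (BV Ω) u).comp (Predual Ω).subtypeL

theorem BV.toDualPredual_apply (u : BV Ω) (p : Predual Ω) :
    BV.toDualPredual u p = (p : StrongDual ℝ (BV Ω)) u := rfl

/-- The functional `D*φ : u ↦ ∫ φ · dDu` on `BV(Ω)`. -/
def gradAdjointFunctional (φ : 𝓓(Ω, Euc d)) : StrongDual ℝ (BV Ω) :=
  LinearMap.mkContinuousOfExistsBound
    { toFun := fun u => pairing φ (BV.grad u)
      map_add' := fun u v => by rw [map_add, pairing_add]
      map_smul' := fun c u => by rw [map_smul, pairing_smul]; rfl }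
    (by
      obtain ⟨C, hC⟩ := abs_pairing_le φ
      refine ⟨|C|, fun u => (hC (BV.grad u)).trans ?_⟩
      refine mul_le_mul (le_abs_self C) ?_ (norm_nonneg _) (abs_nonneg _)
      rw [BV.norm_def]
      linarith [norm_nonneg (BV.toL1 u)])

/-- `D*φ = -div φ`. -/
theorem gradAdjointFunctional_eq (φ : 𝓓(Ω, Euc d)) :
    gradAdjointFunctional φ = - testFunctional (divergence φ) := by
  ext u
  have h := BV.isWeakGradient u φ
  change pairing φ (BV.grad u) = - ∫ x : Ω, BV.toL1 u x * divergence φ x ∂(lebesgue Ω)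
  rw [h, neg_neg]

/-- `D*φ` as an element of the predual `Z`. -/
def gradAdjoint (φ : 𝓓(Ω, Euc d)) : Predual Ω :=
  ⟨gradAdjointFunctional φ, by
    rw [gradAdjointFunctional_eq]
    exact neg_mem (Submodule.le_topologicalClosure _
      (Submodule.subset_span (Set.mem_range_self _)))⟩

/-! ### Convex conjugates, the functional `F` and the regulariser -/

/-- The convex conjugate `F*(ℓ) = sup_p (⟨ℓ, p⟩ - F(p))`, a function on the dual space. -/
def convexConjugate {X : Type*} [NormedAddCommGroup X] [NormedSpace ℝ X] (F : X → EReal)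
    (ℓ : StrongDual ℝ X) : EReal :=
  ⨆ p : X, ((ℓ p : ℝ) : EReal) - F p

/-- `F(p) = inf ∫ |φ| dγ` over the test vector fields `φ` with `|φ| ≤ 1` and `D*φ = p`
(and `F(p) = +∞` if there are none). -/
def conjFunctional (γ : Measure Ω) (p : Predual Ω) : EReal :=
  ⨅ φ : {φ : 𝓓(Ω, Euc d) // (∀ x, ‖φ x‖ ≤ 1) ∧ gradAdjoint φ = p},
    ((∫ x : Ω, ‖φ.1 x‖ ∂γ : ℝ) : EReal)

/-- `TV_pwL^γ(u) = inf ‖Du - g‖` over the vector measures `g` with `|g| ≤ γ`. -/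
def tvPwL (γ : Measure Ω) (u : BV Ω) : ℝ :=
  ⨅ g : {g : RadonMeasure Ω // (g : VectorMeasure Ω (Euc d)).variation ≤ γ}, ‖BV.grad u - g.1‖

end TVpwL

end

noncomputable section

namespace TVpwL

variable {d : ℕ} {Ω : Opens (Euc d)}

/-! Write `μ` for `Du`. As `F` is `+∞` off the range of `D*`, the conjugate at `u` is the supremum
of `∫ φ · dμ - ∫ |φ| dγ` over test fields with `|φ| ≤ 1`; only `μ` matters. Splitting `μ = (μ - g) +
g` bounds each such value by `‖μ - g‖` for every admissible `g` (`pairing_sub_integral_norm_le`).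

Equality needs neither compactness nor a minimax theorem, because the optimal `g` is explicit: `g =
min(1, dγ/d|μ|) μ`. What it leaves is the excess of `|μ|` over `γ`, whose mass is `|μ|(P) - γ(P)`
for a set `P` as in a Hahn decomposition (`exists_radonMeasure_norm_sub_le`). Conversely, a field
close to the direction of `μ` on `P` and to zero elsewhere has value nearly `|μ|(P) - γ(P)`
(`exists_test_excess_le`). This squeeze gives both the duality formula and the minimality of `g`. -/

/-! ### Truncation of one measure by another -/

/-- Given finite measures `γ` and `ν`, a density `0 ≤ ρ ≤ 1` such that `ρ ν ≤ γ`, and such that the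
remaining mass of `(1 - ρ) ν` is the excess of `ν` over `γ` on a suitable set. -/
theorem exists_truncation_density {X : Type*} [MeasurableSpace X] (γ ν : Measure X)
    [IsFiniteMeasure γ] [IsFiniteMeasure ν] :
    ∃ ρ : X → ℝ, Measurable ρ ∧ (∀ x, 0 ≤ ρ x) ∧ (∀ x, ρ x ≤ 1) ∧
      ν.withDensity (fun x => ‖ρ x‖ₑ) ≤ γ ∧
      ∃ P, MeasurableSet P ∧ ∫⁻ x, ‖1 - ρ x‖ₑ ∂ν + γ P = ν P := by
  set r := γ.rnDeriv ν
  have hrm : Measurable r := Measure.measurable_rnDeriv γ ν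
  have hρ : ∀ x, ‖(min 1 (r x)).toReal‖ₑ = min 1 (r x) := fun x => by
    rw [Real.enorm_of_nonneg ENNReal.toReal_nonneg, ENNReal.ofReal_toReal]
    exact ne_top_of_le_ne_top ENNReal.one_ne_top (min_le_left _ _)
  have hρ1 : ∀ x, (min 1 (r x)).toReal ≤ 1 := fun x => by
    simpa using ENNReal.toReal_mono ENNReal.one_ne_top (min_le_left 1 (r x))
  -- Subtraction in `ℝ≥0∞` is truncated, so the right side is the positive part of `1 - r`.
  have hρ' : ∀ x, ‖1 - (min 1 (r x)).toReal‖ₑ = 1 - r x := fun x => by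
    rw [Real.enorm_of_nonneg (sub_nonneg.2 (hρ1 x)),
      ENNReal.ofReal_sub _ ENNReal.toReal_nonneg, ENNReal.ofReal_toReal
      (ne_top_of_le_ne_top ENNReal.one_ne_top (min_le_left _ _)), ENNReal.ofReal_one]
    rcases le_total 1 (r x) with h | h <;> simp [h, tsub_eq_zero_of_le]
  refine ⟨fun x => (min 1 (r x)).toReal, (measurable_const.min hrm).ennreal_toReal,
    fun _ => ENNReal.toReal_nonneg, hρ1, ?_, ?_⟩
  · simp_rw [hρ]
    exact (withDensity_mono (.of_forall fun x => min_le_right _ _)).trans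
      (Measure.withDensity_rnDeriv_le γ ν)
  · have hs := Measure.mutuallySingular_singularPart γ ν
    have hlt : MeasurableSet {x | r x < 1} := measurableSet_lt hrm measurable_const
    -- `hs.nullSet` has full `ν`-measure and is null for the singular part of `γ`. Intersecting with
    -- it costs nothing in `ν`, and on the intersection `γ` is just `r ν`.
    have hP : MeasurableSet ({x | r x < 1} ∩ hs.nullSet) := hlt.inter hs.measurableSet_nullSet
    refine ⟨_, hP, ?_⟩
    have hγ : γ ({x | r x < 1} ∩ hs.nullSet) = ∫⁻ x in {x | r x < 1} ∩ hs.nullSet, r x ∂ν := by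
      have h := congrArg (fun m : Measure X => m ({x | r x < 1} ∩ hs.nullSet))
        (Measure.rnDeriv_add_singularPart γ ν)
      rw [← h, Measure.add_apply, withDensity_apply _ hP,
        measure_mono_null Set.inter_subset_right hs.measure_nullSet, add_zero]
    have hν : ∫⁻ x, (1 - r x) ∂ν = ∫⁻ x in {x | r x < 1} ∩ hs.nullSet, (1 - r x) ∂ν := by
      rw [← lintegral_indicator hP]
      refine lintegral_congr_ae ?_
      have h0 : ∀ᵐ x ∂ν, x ∈ hs.nullSet := by
        rw [ae_iff]
        exact hs.measure_compl_nullSet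
      filter_upwards [h0] with x hx
      by_cases h : r x < 1
      · exact (Set.indicator_of_mem (s := {x | r x < 1} ∩ hs.nullSet) ⟨h, hx⟩ (fun x => 1 - r x)).symm
      · rw [Set.indicator_of_notMem (fun hmem => h hmem.1), tsub_eq_zero_of_le (not_lt.1 h)]
    simp_rw [hρ']
    rw [hν, hγ, ← lintegral_add_right _ hrm, ← setLIntegral_one]
    exact setLIntegral_congr_fun hP fun x hx => tsub_add_cancel_of_le (le_of_lt hx.1)

/-! ### Approximation by test functions -/

/-- A continuous function with values in the unit ball is uniformly approximated by smooth
functions with values in the unit ball, without enlarging the support. -/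
theorem exists_contDiff_approx_norm_le_one {E F : Type*} [NormedAddCommGroup E] [NormedSpace ℝ E]
    [FiniteDimensional ℝ E] [NormedAddCommGroup F] [NormedSpace ℝ F] {f : E → F}
    (hf : Continuous f) (hf1 : ∀ x, ‖f x‖ ≤ 1) {ε : ℝ} (hε : 0 < ε) :
    ∃ g : E → F, ContDiff ℝ ((⊤ : ℕ∞) : WithTop ℕ∞) g ∧ (∀ x, ‖g x‖ ≤ 1) ∧
      (∀ x, ‖f x - g x‖ ≤ ε) ∧ Function.support g ⊆ Function.support f := by
  -- All constraints on `g x` are convex, so local constants can be glued by a smooth partition of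
  -- unity. The last one makes `g` vanish wherever `f` does; the constant `f x` satisfies it near
  -- `x` because `f ≠ 0` is an open condition.
  let t : E → Set F := fun x =>
    Metric.closedBall 0 1 ∩ (Metric.closedBall (f x) ε ∩ {y | f x = 0 → y = 0})
  have ht : ∀ x, Convex ℝ (t x) := fun x => (convex_closedBall 0 1).inter
    ((convex_closedBall (f x) ε).inter (convex_singleton _).setOfPred_const_imp)
  obtain ⟨g, hg⟩ := exists_contMDiffMap_forall_mem_convex_of_local_const
    (n := (⊤ : ℕ∞)) (modelWithCornersSelf ℝ E) ht fun x => by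
      refine ⟨f x, ?_⟩
      have h1 : ∀ᶠ y in nhds x, dist (f x) (f y) < ε :=
        (continuous_const.dist hf).continuousAt.eventually_lt continuousAt_const (by simpa)
      have h2 : ∀ᶠ y in nhds x, f y = 0 → f x = 0 := by
        by_cases hx : f x = 0
        · simp [hx]
        · filter_upwards [hf.continuousAt.eventually_ne hx] with y hy h0
          exact absurd h0 hy
      filter_upwards [h1, h2] with y hy1 hy2
      exact ⟨by simpa using hf1 x, hy1.le, hy2⟩
  refine ⟨g, g.contMDiff.contDiff, fun x => by simpa using (hg x).1, fun x => ?_,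
    fun x => mt (hg x).2.2⟩
  rw [← dist_eq_norm, dist_comm]
  exact (hg x).2.1

/-- A measurable vector field with values in the unit ball is approximated, in the mean with respect
to a finite measure, by test vector fields with values in the unit ball. -/
theorem exists_test_approx (m : Measure Ω) [IsFiniteMeasure m] {ψ : Ω → Euc d}
    (hψ : AEStronglyMeasurable ψ m) (hψ1 : ∀ x, ‖ψ x‖ ≤ 1) {ε : ℝ} (hε : 0 < ε) :
    ∃ φ : 𝓓(Ω, Euc d), (∀ x, ‖φ x‖ ≤ 1) ∧ ∫ x : Ω, ‖ψ x - φ x‖ ∂m ≤ ε := by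
  have : LocallyCompactSpace Ω := Ω.isOpen.locallyCompactSpace
  have hψi : Integrable ψ m := .of_bound hψ 1 (.of_forall hψ1)
  -- Error budget: `δ` for the `L¹` approximation `h`, `δ` again for pushing `h` into the unit ball,
  -- and `δ` uniformly for smoothing.
  obtain ⟨δ, hδ, hδε⟩ : ∃ δ : ℝ, 0 < δ ∧ 2 * δ + δ * m.real Set.univ ≤ ε := by
    have hpos : 0 < 2 + m.real Set.univ := by positivity
    refine ⟨ε / (2 + m.real Set.univ), by positivity, le_of_eq ?_⟩
    field_simp
  obtain ⟨h, hhs, hhψ, hhc, hhi⟩ := hψi.exists_hasCompactSupport_integral_sub_le hδ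
  -- Radial retraction onto the unit ball. It moves `h x` by the positive part of `‖h x‖ - 1`, which
  -- is at most `‖ψ x - h x‖` since `‖ψ x‖ ≤ 1`.
  let k : Ω → Euc d := fun x => (max 1 ‖h x‖)⁻¹ • h x
  have hpos : ∀ x, 0 < max 1 ‖h x‖ := fun x => lt_max_of_lt_left one_pos
  have hkc : Continuous k :=
    ((continuous_const.max hhc.norm).inv₀ fun x => (hpos x).ne').smul hhc
  have hks : HasCompactSupport k := hhs.smul_left (f := fun x => (max 1 ‖h x‖)⁻¹)
  have hk1 : ∀ x, ‖k x‖ ≤ 1 := fun x => by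
    rw [norm_smul, norm_inv, Real.norm_of_nonneg (hpos x).le, inv_mul_le_iff₀ (hpos x), mul_one]
    exact le_max_right _ _
  have hkh : ∀ x, ‖h x - k x‖ ≤ ‖ψ x - h x‖ := fun x => by
    have h1 : h x - k x = (1 - (max 1 ‖h x‖)⁻¹) • h x := by rw [sub_smul, one_smul]
    have h2 : 0 ≤ 1 - (max 1 ‖h x‖)⁻¹ := sub_nonneg.2 (inv_le_one_of_one_le₀ (le_max_left _ _))
    rw [h1, norm_smul, Real.norm_of_nonneg h2]
    rcases le_total ‖h x‖ 1 with hx | hx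
    · simp [max_eq_left hx]
    · rw [max_eq_right hx, sub_mul, one_mul, inv_mul_cancel₀ (by linarith), norm_sub_rev]
      linarith [norm_sub_norm_le (h x) (ψ x), hψ1 x]
  -- Smoothing takes place on the whole space; the extension by zero stays continuous because `k`
  -- has compact support in `Ω`.
  let K : Euc d → Euc d := Function.extend Subtype.val k 0
  have hK : ∀ x : Ω, K x = k x := fun x => Subtype.val_injective.extend_apply _ _ _
  have hKc : Continuous K := HasCompactSupport.continuous_extend_zero Ω.isOpen hkc hks
  have hK1 : ∀ x, ‖K x‖ ≤ 1 := fun x => by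
    by_cases hx : x ∈ Ω
    · exact (hK ⟨x, hx⟩).symm ▸ hk1 ⟨x, hx⟩
    · have : K x = 0 := Function.extend_apply' _ _ _ (by rintro ⟨y, rfl⟩; exact hx y.2)
      simp [this]
  have hKs : HasCompactSupport K := hks.extend_zero continuous_subtype_val
  have hKΩ : tsupport K ⊆ Ω :=
    (hks.tsupport_extend_zero_subset continuous_subtype_val).trans (by
      rintro _ ⟨y, -, rfl⟩; exact y.2)
  obtain ⟨g, hg, hg1, hgK, hgs⟩ := exists_contDiff_approx_norm_le_one hKc hK1 hδ
  let φ : 𝓓(Ω, Euc d) :=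
    { toFun := g
      contDiff' := hg
      hasCompactSupport' := hKs.mono hgs
      tsupport_subset' := (closure_mono hgs).trans hKΩ }
  refine ⟨φ, hg1, ?_⟩
  have hφ : ∀ x : Ω, ‖ψ x - φ x‖ ≤ 2 * ‖ψ x - h x‖ + δ := fun x => by
    have h1 : ‖k x - φ x‖ ≤ δ := hK x ▸ hgK x
    calc ‖ψ x - φ x‖ = ‖(ψ x - h x) + (h x - k x) + (k x - φ x)‖ := by congr 1; abel
      _ ≤ ‖ψ x - h x‖ + ‖h x - k x‖ + ‖k x - φ x‖ := norm_add₃_le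
      _ ≤ 2 * ‖ψ x - h x‖ + δ := by linarith [hkh x]
  have hi : Integrable (fun x => 2 * ‖ψ x - h x‖) m := (hψi.sub hhi).norm.const_mul 2
  calc ∫ x : Ω, ‖ψ x - φ x‖ ∂m ≤ ∫ x, (2 * ‖ψ x - h x‖ + δ) ∂m :=
        integral_mono_of_nonneg (.of_forall fun _ => norm_nonneg _)
          (hi.add (integrable_const δ)) (.of_forall hφ)
    _ = 2 * ∫ x, ‖ψ x - h x‖ ∂m + δ * m.real Set.univ := by
        rw [integral_add hi (integrable_const δ), integral_const_mul, integral_const, smul_eq_mul,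
          mul_comm δ]
    _ ≤ ε := by linarith

/-! ### Vector measures with a scalar density -/

/-- Scalar multiplication has norm at most one, and the variation is the least measure dominating
the norms of the values. The inequality suffices: the matching lower bound comes from duality. -/
theorem variation_withDensity_lsmul_le {X : Type*} [MeasurableSpace X] {F : Type*}
    [NormedAddCommGroup F] [NormedSpace ℝ F] (μ : VectorMeasure X F) {f : X → ℝ}
    (hf : μ.Integrable f) :
    (μ.withDensity f (ContinuousLinearMap.lsmul ℝ ℝ)).variation ≤
      μ.variation.withDensity (fun x => ‖f x‖ₑ) := by
  refine VectorMeasure.variation_le_of_forall_enorm_le fun s hs => ?_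
  rw [VectorMeasure.withDensity_apply hf, withDensity_apply _ hs]
  refine VectorMeasure.enorm_setIntegral_le_lintegral_enorm.trans ?_
  refine mul_le_of_le_one_left zero_le ?_
  rw [← ofReal_norm, ENNReal.ofReal_le_one]
  exact ContinuousLinearMap.opNorm_lsmul_le

/-- Puts `μ - g` in density form, so that the preceding variation bound applies to it. -/
theorem sub_withDensity_lsmul {X : Type*} [MeasurableSpace X] {F : Type*}
    [NormedAddCommGroup F] [NormedSpace ℝ F] [CompleteSpace F] (μ : VectorMeasure X F)
    [IsFiniteMeasure μ.variation] {f : X → ℝ} (hf : μ.Integrable f) :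
    μ - μ.withDensity f (ContinuousLinearMap.lsmul ℝ ℝ) =
      μ.withDensity (fun x => 1 - f x) (ContinuousLinearMap.lsmul ℝ ℝ) := by
  have h1 : μ.Integrable (fun _ : X => (1 : ℝ)) := integrable_const (μ := μ.variation) 1
  refine VectorMeasure.ext fun s hs => ?_
  have hs1 : (μ.restrict s).Integrable (fun _ : X => (1 : ℝ)) := h1.restrict
  have h1f : μ.Integrable (fun x => 1 - f x) := h1.sub hf
  rw [VectorMeasure.withDensity_apply h1f, VectorMeasure.integral_fun_sub hs1 hf.restrict,
    VectorMeasure.setIntegral_const, sub_apply, VectorMeasure.withDensity_apply hf]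
  simp

/-- The vector measure `g = ρ μ`, for the truncation density `ρ`, satisfies `|g| ≤ γ`, and
`‖μ - g‖` is at most the excess of `|μ|` over `γ` on some set. -/
theorem exists_radonMeasure_norm_sub_le (γ : Measure Ω) [IsFiniteMeasure γ] (μ : RadonMeasure Ω) :
    ∃ g : RadonMeasure Ω, (g : VectorMeasure Ω (Euc d)).variation ≤ γ ∧
      ∃ P, MeasurableSet P ∧
        ‖μ - g‖ ≤ (μ : VectorMeasure Ω (Euc d)).variation.real P - γ.real P := by
  obtain ⟨ρ, hρm, hρ0, hρ1, hργ, P, hP, hPe⟩ :=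
    exists_truncation_density γ (μ : VectorMeasure Ω (Euc d)).variation
  have hρi : (μ : VectorMeasure Ω (Euc d)).Integrable ρ :=
    Integrable.of_bound (μ := (μ : VectorMeasure Ω (Euc d)).variation)
      hρm.aestronglyMeasurable 1
      (.of_forall fun x => by rw [Real.norm_of_nonneg (hρ0 x)]; exact hρ1 x)
  have hgγ := (variation_withDensity_lsmul_le _ hρi).trans hργ
  let g : RadonMeasure Ω := ⟨_, isFiniteMeasure_of_le γ hgγ⟩
  refine ⟨g, hgγ, P, hP, ?_⟩
  have hsub : ((μ - g : RadonMeasure Ω) : VectorMeasure Ω (Euc d)) =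
      (μ : VectorMeasure Ω (Euc d)).withDensity (fun x => 1 - ρ x)
        (ContinuousLinearMap.lsmul ℝ ℝ) := sub_withDensity_lsmul _ hρi
  have hle : ((μ - g : RadonMeasure Ω) : VectorMeasure Ω (Euc d)).variation Set.univ ≤
      ∫⁻ x, ‖1 - ρ x‖ₑ ∂(μ : VectorMeasure Ω (Euc d)).variation := by
    rw [hsub]
    refine (variation_withDensity_lsmul_le _ ?_ _).trans_eq ?_
    · exact (integrable_const (μ := (μ : VectorMeasure Ω (Euc d)).variation) (1 : ℝ)).sub hρi
    · rw [withDensity_apply _ MeasurableSet.univ, setLIntegral_univ]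
  rw [le_sub_iff_add_le, RadonMeasure.norm_def, Measure.real, Measure.real, Measure.real,
    ← ENNReal.toReal_add (by finiteness) (by finiteness), ← hPe]
  exact ENNReal.toReal_mono (by rw [hPe]; finiteness) (by gcongr)

/-! ### Duality between test fields and vector measures -/

theorem abs_integral_inner_le (μ : VectorMeasure Ω (Euc d)) (f : Ω → Euc d) :
    |∫ᵛ x, f x ∂[innerSL ℝ; μ]| ≤ ∫ x, ‖f x‖ ∂μ.variation := by
  refine (VectorMeasure.norm_integral_le_integral_norm (B := innerSL ℝ) (μ := μ)).trans ?_
  exact mul_le_of_le_one_left (integral_nonneg fun _ => norm_nonneg _) (norm_innerSL_le ℝ)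

theorem integrable_norm_test (m : Measure Ω) [IsFiniteMeasure m] (φ : 𝓓(Ω, Euc d)) :
    Integrable (fun x : Ω => φ x) m := by
  obtain ⟨C, hC⟩ := φ.continuous.bounded_above_of_compact_support φ.hasCompactSupport
  exact .of_bound (φ.continuous.comp continuous_subtype_val).aestronglyMeasurable C
    (.of_forall fun x => hC x)

/-- Weak duality. -/
theorem pairing_sub_integral_norm_le (γ : Measure Ω) [IsFiniteMeasure γ] (μ g : RadonMeasure Ω)
    (hg : (g : VectorMeasure Ω (Euc d)).variation ≤ γ) (φ : 𝓓(Ω, Euc d)) (hφ : ∀ x, ‖φ x‖ ≤ 1) :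
    pairing φ μ - ∫ x : Ω, ‖φ x‖ ∂γ ≤ ‖μ - g‖ := by
  have h1 : pairing φ (μ - g) ≤ ‖μ - g‖ := by
    refine (le_abs_self _).trans ((abs_integral_inner_le _ _).trans ?_)
    refine (integral_mono (integrable_norm_test _ φ).norm (integrable_const 1)
      fun x => hφ x).trans_eq ?_
    rw [integral_const, smul_eq_mul, mul_one, RadonMeasure.norm_def]
  have h2 : pairing φ g ≤ ∫ x : Ω, ‖φ x‖ ∂γ :=
    (le_abs_self _).trans ((abs_integral_inner_le _ _).trans
      (integral_mono_measure hg (.of_forall fun _ => norm_nonneg _)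
        (integrable_norm_test γ φ).norm))
  have h3 := pairing_add φ (μ - g) g
  rw [sub_add_cancel] at h3
  linarith

/-- A simple vector field with values in the unit ball which is supported in `P` and almost realises
the variation of `μ` on `P`. -/
theorem exists_field_variation_le (μ : VectorMeasure Ω (Euc d)) [IsFiniteMeasure μ.variation]
    {P : Set Ω} (hP : MeasurableSet P) {ε : ℝ} (hε : 0 < ε) :
    ∃ ψ : Ω → Euc d, StronglyMeasurable ψ ∧ (∀ x, ‖ψ x‖ ≤ P.indicator 1 x) ∧
      μ.variation.real P ≤ ∫ᵛ x, ψ x ∂[innerSL ℝ; μ] + ε := by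
  obtain ⟨Q, hQP, hQd, hQm, hQ⟩ := μ.exists_variation_le_add' hP (ENNReal.ofReal_pos.2 hε)
    (measure_ne_top _ _)
  -- The direction of `μ A`, or zero if `μ A = 0`. Since the field equals `e A` on each piece `A`,
  -- it integrates to `∑ ‖μ A‖`; no polar decomposition of `μ` is needed.
  let e : Set Ω → Euc d := fun A => ‖μ A‖⁻¹ • μ A
  have he : ∀ A, ‖e A‖ ≤ 1 := fun A => by
    rw [norm_smul, norm_inv, norm_norm]
    exact inv_mul_le_one
  have heμ : ∀ A, innerSL ℝ (e A) (μ A) = ‖μ A‖ := fun A => by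
    rw [innerSL_apply_apply, real_inner_smul_left, real_inner_self_eq_norm_sq]
    by_cases h : ‖μ A‖ = 0
    · simp [h]
    · field_simp
  refine ⟨fun x => ∑ A ∈ Q, A.indicator (fun _ => e A) x, ?_, fun x => ?_, ?_⟩
  · exact Finset.stronglyMeasurable_fun_sum _ fun A hA =>
      stronglyMeasurable_const.indicator (hQm A hA)
  · dsimp only
    by_cases hx : ∃ A ∈ Q, x ∈ A
    · obtain ⟨A, hA, hxA⟩ := hx
      rw [Finset.sum_eq_single A, Set.indicator_of_mem hxA, Set.indicator_of_mem (hQP A hA hxA)]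
      · exact he A
      · intro B hB hBA
        exact Set.indicator_of_notMem
          (fun hxB => (Set.disjoint_left.1 (hQd hB hA hBA)) hxB hxA) _
      · exact fun h => absurd hA h
    · push Not at hx
      rw [Finset.sum_eq_zero fun A hA => Set.indicator_of_notMem (hx A hA) _, norm_zero]
      exact Set.indicator_nonneg (fun _ _ => zero_le_one) _
  · have hi : ∀ A ∈ Q, μ.Integrable (A.indicator fun _ => e A) := fun A hA =>
      (integrable_const (μ := μ.variation) (e A)).indicator (hQm A hA)
    rw [VectorMeasure.integral_finsetSum Q hi, Finset.sum_congr rfl fun A hA =>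
      (VectorMeasure.integral_indicator_const (e A) (hQm A hA)).trans (heμ A)]
    have hfin : ∑ A ∈ Q, ‖μ A‖ₑ ≠ ⊤ := ENNReal.sum_ne_top.2 fun A _ => enorm_ne_top
    have h := ENNReal.toReal_mono (by finiteness) hQ
    rwa [ENNReal.toReal_add hfin (by finiteness), ENNReal.toReal_sum
      (fun _ _ => by finiteness), ENNReal.toReal_ofReal hε.le,
      Finset.sum_congr rfl fun A _ => toReal_enorm (μ A)] at h

/-- Strong duality, up to an arbitrarily small error. -/
theorem exists_test_excess_le (γ : Measure Ω) [IsFiniteMeasure γ] (μ : RadonMeasure Ω)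
    {P : Set Ω} (hP : MeasurableSet P) {ε : ℝ} (hε : 0 < ε) :
    ∃ φ : 𝓓(Ω, Euc d), (∀ x, ‖φ x‖ ≤ 1) ∧
      (μ : VectorMeasure Ω (Euc d)).variation.real P - γ.real P ≤
        pairing φ μ - ∫ x : Ω, ‖φ x‖ ∂γ + ε := by
  set ν := (μ : VectorMeasure Ω (Euc d)).variation
  obtain ⟨ψ, hψm, hψP, hψ⟩ := exists_field_variation_le (μ : VectorMeasure Ω (Euc d)) hP
    (half_pos hε)
  have hψ1 : ∀ x, ‖ψ x‖ ≤ 1 := fun x =>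
    (hψP x).trans (Set.indicator_le_self' (fun _ _ => zero_le_one) x)
  have hψi : ∀ m : Measure Ω, IsFiniteMeasure m → Integrable ψ m := fun m _ =>
    .of_bound hψm.aestronglyMeasurable 1 (.of_forall hψ1)
  -- Approximating with respect to the sum `ν + γ` controls the change of the pairing and of the
  -- penalty together, within `ε / 2`.
  obtain ⟨φ, hφ, hψφ⟩ := exists_test_approx (ν + γ) hψm.aestronglyMeasurable hψ1 (half_pos hε)
  have hd : ∀ m : Measure Ω, IsFiniteMeasure m → Integrable (fun x : Ω => ψ x - φ x) m :=
    fun m hm => (hψi m hm).sub (integrable_norm_test m φ)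
  rw [integral_add_measure (hd ν inferInstance).norm (hd γ inferInstance).norm] at hψφ
  refine ⟨φ, hφ, ?_⟩
  have h1 : ∫ᵛ x, ψ x ∂[innerSL ℝ; (μ : VectorMeasure Ω (Euc d))] - pairing φ μ ≤
      ∫ x : Ω, ‖ψ x - φ x‖ ∂ν := by
    rw [pairing, ← VectorMeasure.integral_fun_sub (hψi ν inferInstance) (integrable_test _ φ)]
    exact (le_abs_self _).trans (abs_integral_inner_le _ _)
  have h2 : ∫ x : Ω, ‖φ x‖ ∂γ ≤ γ.real P + ∫ x : Ω, ‖ψ x - φ x‖ ∂γ := by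
    have hPi : Integrable (P.indicator (1 : Ω → ℝ)) γ := (integrable_const 1).indicator hP
    rw [← integral_indicator_one hP, ← integral_add hPi (hd γ inferInstance).norm]
    refine integral_mono (integrable_norm_test γ φ).norm (hPi.add (hd γ inferInstance).norm)
      fun x => ?_
    have := norm_sub_norm_le (φ x) (ψ x)
    rw [norm_sub_rev] at this
    change ‖φ x‖ ≤ P.indicator 1 x + ‖ψ x - φ x‖
    linarith [hψP x]
  linarith

/-! ### The convex conjugate -/

theorem convexConjugate_conjFunctional_le (γ : Measure Ω) (u : BV Ω) {c : ℝ}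
    (hc : ∀ φ : 𝓓(Ω, Euc d), (∀ x, ‖φ x‖ ≤ 1) →
      pairing φ (BV.grad u) - ∫ x : Ω, ‖φ x‖ ∂γ ≤ c) :
    convexConjugate (conjFunctional γ) (BV.toDualPredual u) ≤ (c : EReal) := by
  refine iSup_le fun p => ?_
  -- With `F` alone on the right, the bound may be checked field by field; if no field represents
  -- `p` it is vacuous, as the empty infimum is `⊤`.
  have h : ((BV.toDualPredual u p - c : ℝ) : EReal) ≤ conjFunctional γ p := by
    refine le_iInf ?_
    rintro ⟨φ, hφ, rfl⟩
    have h1 : BV.toDualPredual u (gradAdjoint φ) = pairing φ (BV.grad u) := rfl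
    rw [h1, EReal.coe_le_coe_iff]
    linarith [hc φ hφ]
  refine EReal.sub_le_of_le_add ?_
  calc ((BV.toDualPredual u p : ℝ) : EReal)
      = (c : EReal) + ((BV.toDualPredual u p - c : ℝ) : EReal) := by
        rw [← EReal.coe_add]; congr 1; ring
    _ ≤ (c : EReal) + conjFunctional γ p := by gcongr

/-- Test the supremum with `p = D*φ`: other fields representing this `p` can only lower `F(p)`. -/
theorem le_convexConjugate_conjFunctional (γ : Measure Ω) (u : BV Ω) (φ : 𝓓(Ω, Euc d))
    (hφ : ∀ x, ‖φ x‖ ≤ 1) :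
    ((pairing φ (BV.grad u) - ∫ x : Ω, ‖φ x‖ ∂γ : ℝ) : EReal) ≤
      convexConjugate (conjFunctional γ) (BV.toDualPredual u) := by
  have h : conjFunctional γ (gradAdjoint φ) ≤ ((∫ x : Ω, ‖φ x‖ ∂γ : ℝ) : EReal) :=
    iInf_le (fun χ : {χ : 𝓓(Ω, Euc d) // (∀ x, ‖χ x‖ ≤ 1) ∧ gradAdjoint χ = gradAdjoint φ} =>
      ((∫ x : Ω, ‖χ.1 x‖ ∂γ : ℝ) : EReal)) ⟨φ, hφ, rfl⟩
  rw [EReal.coe_sub]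
  exact (EReal.sub_le_sub le_rfl h).trans (le_iSup (fun p : Predual Ω =>
    ((BV.toDualPredual u p : ℝ) : EReal) - conjFunctional γ p) (gradAdjoint φ))

/-- An admissible `g` of minimal distance to `Du` attains the infimum in `tvPwL`. -/
theorem norm_grad_sub_eq_tvPwL (γ : Measure Ω) (u : BV Ω) {g : RadonMeasure Ω}
    (hg : (g : VectorMeasure Ω (Euc d)).variation ≤ γ)
    (hmin : ∀ g' : RadonMeasure Ω, (g' : VectorMeasure Ω (Euc d)).variation ≤ γ →
      ‖BV.grad u - g‖ ≤ ‖BV.grad u - g'‖) :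
    ‖BV.grad u - g‖ = tvPwL γ u := by
  let f : {g : RadonMeasure Ω // (g : VectorMeasure Ω (Euc d)).variation ≤ γ} → ℝ :=
    fun g' => ‖BV.grad u - g'.1‖
  -- A real infimum defaults to `0` on an empty or unbounded-below family; both cases must be
  -- excluded.
  have : Nonempty {g : RadonMeasure Ω // (g : VectorMeasure Ω (Euc d)).variation ≤ γ} :=
    ⟨⟨g, hg⟩⟩
  have hbdd : BddBelow (Set.range f) := ⟨0, by rintro _ ⟨g', rfl⟩; exact norm_nonneg _⟩
  exact le_antisymm (le_ciInf (f := f) fun g' => hmin g'.1 g'.2) (ciInf_le hbdd ⟨g, hg⟩)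

end TVpwL

end

theorem mainTheorem4 (d : ℕ) (Ω : TopologicalSpace.Opens (TVpwL.Euc d))
    (γ : MeasureTheory.Measure Ω) [MeasureTheory.IsFiniteMeasure γ] (u : TVpwL.BV Ω) :
    TVpwL.convexConjugate (TVpwL.conjFunctional γ) (TVpwL.BV.toDualPredual u) =
        ((TVpwL.tvPwL γ u : ℝ) : EReal) ∧
      ∃ g : TVpwL.RadonMeasure Ω,
        (g : MeasureTheory.VectorMeasure Ω (TVpwL.Euc d)).variation ≤ γ ∧
          ‖TVpwL.BV.grad u - g‖ = TVpwL.tvPwL γ u := by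
  obtain ⟨g, hg, P, hP, hgP⟩ := TVpwL.exists_radonMeasure_norm_sub_le γ (TVpwL.BV.grad u)
  have hmin : ∀ g' : TVpwL.RadonMeasure Ω,
      (g' : VectorMeasure Ω (TVpwL.Euc d)).variation ≤ γ →
        ‖TVpwL.BV.grad u - g‖ ≤ ‖TVpwL.BV.grad u - g'‖ := by
    -- Up to `ε`, the value of a single test field lies above `‖Du - g‖` and, by weak duality, below
    -- `‖Du - g'‖`.
    refine fun g' hg' => le_of_forall_pos_le_add fun ε hε => ?_
    obtain ⟨φ, hφ, h⟩ := TVpwL.exists_test_excess_le γ (TVpwL.BV.grad u) hP hε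
    linarith [TVpwL.pairing_sub_integral_norm_le γ (TVpwL.BV.grad u) g' hg' φ hφ]
  have htv := TVpwL.norm_grad_sub_eq_tvPwL γ u hg hmin
  refine ⟨?_, g, hg, htv⟩
  rw [← htv]
  refine le_antisymm (TVpwL.convexConjugate_conjFunctional_le γ u fun φ hφ =>
    TVpwL.pairing_sub_integral_norm_le γ (TVpwL.BV.grad u) g hg φ hφ) ?_
  refine EReal.ge_of_forall_gt_iff_ge.1 fun c hc => ?_
  -- The admissible error is the gap `‖Du - g‖ - c`, so the value of `φ` is at least `c`.
  obtain ⟨φ, hφ, h⟩ := TVpwL.exists_test_excess_le γ (TVpwL.BV.grad u) hP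
    (sub_pos.2 (EReal.coe_lt_coe_iff.1 hc))
  refine le_trans (EReal.coe_le_coe_iff.2 ?_)
    (TVpwL.le_convexConjugate_conjFunctional γ u φ hφ)
  linarith
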